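/- **Theorem 1.3 (Liouville-type result I).** Let $n\ge 2$, $0\le m<3$ and $\alpha>-\tfrac43 m$. Write $\Delta_\infty\varphi(x)=\langle D^2\varphi(x)D\varphi(x),D\varphi(x)\rangle$. Let $u:\mathbb{R}^n\to[0,\infty)$ be a non-negative entire viscosity solution of $$\Delta_\infty u(x)=|x|^\alpha u^m(x)\quad\text{in }\mathbb{R}^n$$ with $u(0)=0$; that is, $u$ is continuous on $\mathbb{R}^n$ and, for every $\varphi\in C^2(\mathbb{R}^n)$ and every $x_0\in\mathbb{R}^n$ (with $x_0\neq 0$ if $\alpha<0$, where the weight $|x|^\alpha$ is singular), - if $u-\varphi$ has a local maximum at $x_0$, then $\Delta_\infty\varphi(x_0)\ge |x_0|^\alpha u(x_0)^m$; - if $u-\varphi$ has a local minimum at $x_0$, then $\Delta_\infty\varphi(x_0)\le |x_0|^\alpha u(x_0)^m$ (with the convention $t^0=1$ for all $t\ge 0$). If $$\lim_{|x|\to\infty}\frac{u(x)}{|x|^{\frac{4+\alpha}{3-m}}}=0,$$ then $u(x)=0$ for every $x\in\mathbb{R}^n$. -/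

import Mathlib

open Filter Topology

/-- The infinity-Laplacian `Δ_∞ φ (x) = ⟨D²φ(x) Dφ(x), Dφ(x)⟩` of a function on `ℝⁿ`, where
`Dφ` is the gradient of `φ` and `D²φ(x)`, the Hessian, is the derivative of the gradient. -/
noncomputable def infLaplacian {n : ℕ} (φ : EuclideanSpace ℝ (Fin n) → ℝ)
    (x : EuclideanSpace ℝ (Fin n)) : ℝ :=
  inner ℝ (fderiv ℝ (gradient φ) x (gradient φ x)) (gradient φ x)

/-- `u` is a viscosity sub-solution of `Δ_∞ u = F(x, u)` at the points of `Ω`: whenever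
`u - φ` has a local maximum at `x ∈ Ω`, with `φ` of class `C²`,
`-Δ_∞ φ(x) ≤ -F(x, u(x))`. -/
def IsViscositySubsolutionOn {n : ℕ} (Ω : Set (EuclideanSpace ℝ (Fin n)))
    (F : EuclideanSpace ℝ (Fin n) → ℝ → ℝ) (u : EuclideanSpace ℝ (Fin n) → ℝ) : Prop :=
  ∀ φ : EuclideanSpace ℝ (Fin n) → ℝ, ContDiff ℝ 2 φ →
    ∀ x ∈ Ω, IsLocalMax (fun y => u y - φ y) x → -infLaplacian φ x ≤ -F x (u x)

/-- `u` is a viscosity super-solution of `Δ_∞ u = F(x, u)` at the points of `Ω`: whenever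
`u - φ` has a local minimum at `x ∈ Ω`, with `φ` of class `C²`,
`-Δ_∞ φ(x) ≥ -F(x, u(x))`. -/
def IsViscositySupersolutionOn {n : ℕ} (Ω : Set (EuclideanSpace ℝ (Fin n)))
    (F : EuclideanSpace ℝ (Fin n) → ℝ → ℝ) (u : EuclideanSpace ℝ (Fin n) → ℝ) : Prop :=
  ∀ φ : EuclideanSpace ℝ (Fin n) → ℝ, ContDiff ℝ 2 φ →
    ∀ x ∈ Ω, IsLocalMin (fun y => u y - φ y) x → -infLaplacian φ x ≥ -F x (u x)

/-- The points of `ℝⁿ` at which the weight `|x|^α` is finite: all of `ℝⁿ` if `α ≥ 0`, and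
`ℝⁿ ∖ {0}` if `α < 0`. -/
def weightDomain (n : ℕ) (α : ℝ) : Set (EuclideanSpace ℝ (Fin n)) :=
  {x | 0 ≤ α ∨ x ≠ 0}

/-- `u` is an entire viscosity solution of `Δ_∞ u = |x|^α u^m` in `ℝⁿ` (for non-negative `u`; as
usual `t^0 = 1` for every `t ≥ 0`): it is continuous on `ℝⁿ` and both a sub- and a
super-solution. For `α < 0` the right-hand side has no value at the origin, and no condition
beyond continuity is imposed there. -/
structure IsEntireViscositySolution {n : ℕ} (α m : ℝ)
    (u : EuclideanSpace ℝ (Fin n) → ℝ) : Prop where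
  continuous : Continuous u
  subsolution : IsViscositySubsolutionOn (weightDomain n α) (fun x t => ‖x‖ ^ α * t ^ m) u
  supersolution : IsViscositySupersolutionOn (weightDomain n α) (fun x t => ‖x‖ ^ α * t ^ m) u

/-! Comparison with radial powers. The exponent `β = (4 + α) / (3 - m)` is the one for which `Δ_∞
(c|x|^β)` and `|x|^α (c|x|^β)^m` are multiples of the same power of `|x|`, with coefficients
`c³β³(β-1)` and `c^m`. Since `m < 3`, the latter is larger for small `c > 0`, so `c|x|^β` is a
strict supersolution away from the origin. If `u` exceeded it somewhere, the growth condition would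
make `u - c|x|^β` attain a positive global maximum, not at `0` because `u(0) = 0`, and testing there
contradicts the subsolution property. Hence `0 ≤ u ≤ c|x|^β`; let `c → 0⁺`. -/

section NormPower

variable {E : Type*} [NormedAddCommGroup E] [InnerProductSpace ℝ E]

/-- The derivative of `‖x‖ ^ p` away from the origin, for an arbitrary real exponent. -/
theorem hasFDerivAt_norm_rpow_of_ne_zero {x : E} (hx : x ≠ 0) (p : ℝ) :
    HasFDerivAt (fun y : E => ‖y‖ ^ p) ((p * ‖x‖ ^ (p - 2)) • innerSL ℝ x) x := by
  have hx' : 0 < ‖x‖ := norm_pos_iff.mpr hx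
  have h1 : HasFDerivAt (fun y : E => (‖y‖ ^ 2) ^ (p / 2)) _ x :=
    (hasStrictFDerivAt_norm_sq x).hasFDerivAt.rpow_const (p := p / 2) (Or.inl (by positivity))
  have h2 : (fun y : E => (‖y‖ ^ 2) ^ (p / 2)) = fun y : E => ‖y‖ ^ p := by
    funext y
    rw [← Real.rpow_natCast, ← Real.rpow_mul (norm_nonneg _)]
    congr 1
    push_cast
    ring
  rw [h2] at h1
  convert h1 using 1
  rw [← Real.rpow_natCast, ← Real.rpow_mul (norm_nonneg _), ← Nat.cast_smul_eq_nsmul ℝ, smul_smul]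
  congr 1
  rw [show ((2 : ℕ) : ℝ) * (p / 2 - 1) = p - 2 by push_cast; ring]
  push_cast
  ring

theorem contDiffAt_norm_rpow_of_ne_zero {x : E} (hx : x ≠ 0) (p : ℝ) {k : WithTop ℕ∞} :
    ContDiffAt ℝ k (fun y : E => ‖y‖ ^ p) x :=
  (contDiffAt_norm ℝ hx).rpow_const_of_ne (norm_ne_zero_iff.mpr hx)

/-- A function of class `C^k` near a point agrees near that point with a function which is of class
`C^k` on the whole space. -/
theorem ContDiffAt.exists_contDiff_eventuallyEq [HasContDiffBump E] {f : E → ℝ} {x : E} {k : ℕ}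
    (hf : ContDiffAt ℝ k f x) : ∃ g : E → ℝ, ContDiff ℝ k g ∧ g =ᶠ[𝓝 x] f := by
  have hev : ∀ᶠ y in 𝓝 x, ContDiffAt ℝ k f y := hf.eventually (by simp)
  obtain ⟨r, hr, hball⟩ := Metric.eventually_nhds_iff_ball.mp hev
  -- The outer radius `r / 2 < r` makes the product with `b` vanish near every point outside the
  -- ball, where `f` may fail to be smooth.
  let b : ContDiffBump x := ⟨r / 4, r / 2, by positivity, by linarith⟩
  refine ⟨fun y => b y * f y, contDiff_iff_contDiffAt.mpr fun y => ?_, ?_⟩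
  · by_cases hy : y ∈ Metric.ball x r
    · exact b.contDiffAt.mul (hball y hy)
    · have hfar : ∀ᶠ z in 𝓝 y, b z * f z = 0 := by
        have hd : r / 2 < Dist.dist y x := by
          have := Metric.mem_ball.not.mp hy
          linarith
        have hc : Continuous fun z : E => Dist.dist z x := by fun_prop
        filter_upwards [hc.continuousAt.eventually (lt_mem_nhds hd)] with z hz
        rw [b.zero_of_le_dist (le_of_lt hz), zero_mul]
      exact contDiffAt_const.congr_of_eventuallyEq (f := fun _ : E => (0 : ℝ)) hfar
  · filter_upwards [b.eventuallyEq_one] with y hy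
    simp [hy]

end NormPower

section InfinityLaplacian

variable {n : ℕ} {x : EuclideanSpace ℝ (Fin n)}

theorem gradient_eq_of_eventuallyEq {φ ψ : EuclideanSpace ℝ (Fin n) → ℝ} (h : φ =ᶠ[𝓝 x] ψ) :
    gradient φ x = gradient ψ x := by
  simp only [gradient, h.fderiv_eq]

/-- The infinity-Laplacian at a point depends only on the germ of the function there. -/
theorem infLaplacian_eq_of_eventuallyEq {φ ψ : EuclideanSpace ℝ (Fin n) → ℝ}
    (h : φ =ᶠ[𝓝 x] ψ) : infLaplacian φ x = infLaplacian ψ x := by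
  have hg : gradient φ =ᶠ[𝓝 x] gradient ψ := by
    filter_upwards [h.eventuallyEq_nhds] with y hy
    exact gradient_eq_of_eventuallyEq hy
  simp only [infLaplacian, hg.fderiv_eq, hg.eq_of_nhds]

theorem gradient_const_mul_norm_rpow (hx : x ≠ 0) (c p : ℝ) :
    gradient (fun y => c * ‖y‖ ^ p) x = (c * p * ‖x‖ ^ (p - 2)) • x := by
  refine HasGradientAt.gradient ?_
  rw [hasGradientAt_iff_hasFDerivAt]
  refine ((hasFDerivAt_norm_rpow_of_ne_zero hx p).const_mul c).congr_fderiv ?_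
  ext v
  simp [mul_assoc]

/-- The infinity-Laplacian of the radial power `c |x|^p` away from the origin. -/
theorem infLaplacian_const_mul_norm_rpow (hx : x ≠ 0) (c p : ℝ) :
    infLaplacian (fun y => c * ‖y‖ ^ p) x
      = c ^ 3 * (p ^ 3 * (p - 1)) * ‖x‖ ^ (3 * p - 4) := by
  have hx' : 0 < ‖x‖ := norm_pos_iff.mpr hx
  have hgrad : gradient (fun y : EuclideanSpace ℝ (Fin n) => c * ‖y‖ ^ p)
      =ᶠ[𝓝 x] fun y => (c * p * ‖y‖ ^ (p - 2)) • y := by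
    filter_upwards [isOpen_ne.mem_nhds hx] with y hy
    exact gradient_const_mul_norm_rpow hy c p
  have hder := ((hasFDerivAt_norm_rpow_of_ne_zero hx (p - 2)).const_mul (c * p)).smul
    (hasFDerivAt_id x)
  -- Differentiating the factor `‖y‖ ^ (p - 2)` produces `‖x‖ ^ (p - 2 - 2)`; the other real powers
  -- are rewritten through it so that `ring` can compare.
  have e1 : ‖x‖ ^ (p - 2) = ‖x‖ ^ (p - 2 - 2) * ‖x‖ ^ 2 := by
    rw [← Real.rpow_natCast, ← Real.rpow_add hx']
    congr 1
    push_cast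
    ring
  have e2 : ‖x‖ ^ (3 * p - 4) = (‖x‖ ^ (p - 2 - 2)) ^ 3 * ‖x‖ ^ 8 := by
    rw [← Real.rpow_natCast, ← Real.rpow_natCast, ← Real.rpow_mul hx'.le, ← Real.rpow_add hx']
    congr 1
    push_cast
    ring
  rw [infLaplacian, hgrad.fderiv_eq, hgrad.eq_of_nhds]
  erw [hder.fderiv]
  simp [inner_smul_left, inner_smul_right, inner_add_left]
  rw [e1, e2]
  ring

/-- A subsolution of `Δ_∞ u = F(x, u)` satisfies the defining inequality with test functions that
are of class `C²` only near the point of contact. -/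
theorem IsViscositySubsolutionOn.le_infLaplacian {Ω : Set (EuclideanSpace ℝ (Fin n))}
    {F : EuclideanSpace ℝ (Fin n) → ℝ → ℝ} {u φ : EuclideanSpace ℝ (Fin n) → ℝ}
    (hu : IsViscositySubsolutionOn Ω F u) (hx : x ∈ Ω) (hφ : ContDiffAt ℝ 2 φ x)
    (hmax : IsLocalMax (fun y => u y - φ y) x) : F x (u x) ≤ infLaplacian φ x := by
  obtain ⟨ψ, hψ, hψφ⟩ := ContDiffAt.exists_contDiff_eventuallyEq (k := 2) hφ
  have hmax' : IsLocalMax (fun y => u y - ψ y) x := by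
    filter_upwards [hmax, hψφ] with y hy hy'
    rw [hy', hψφ.eq_of_nhds]
    exact hy
  have := hu ψ hψ x hx hmax'
  rw [infLaplacian_eq_of_eventuallyEq hψφ] at this
  linarith

end InfinityLaplacian

/-- Comparison of a subsolution of `Δ_∞ u = |x|^α u^m` that vanishes at the origin and is of growth
`o(|x|^β)`, with `β = (4 + α) / (3 - m)`, with a strict radial supersolution `c |x|^β`. -/
theorem IsViscositySubsolutionOn.le_const_mul_norm_rpow {n : ℕ} {m α β c : ℝ} (hm : 0 ≤ m)
    (hβ : 0 < β) (hβ' : 3 * β - 4 = α + β * m) (hc : 0 < c)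
    (hcβ : c ^ 3 * (β ^ 3 * (β - 1)) < c ^ m) {u : EuclideanSpace ℝ (Fin n) → ℝ}
    (hcont : Continuous u)
    (hu : IsViscositySubsolutionOn (weightDomain n α) (fun x t => ‖x‖ ^ α * t ^ m) u)
    (hu_zero : u 0 = 0)
    (hu_lim : Tendsto (fun x => u x / ‖x‖ ^ β) (cocompact (EuclideanSpace ℝ (Fin n))) (𝓝 0))
    (x : EuclideanSpace ℝ (Fin n)) : u x ≤ c * ‖x‖ ^ β := by
  by_contra! hx
  -- Far out the difference is negative, while at `x` it is positive by assumption.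
  have hfar : ∀ᶠ y in cocompact (EuclideanSpace ℝ (Fin n)),
      u y - c * ‖y‖ ^ β ≤ u x - c * ‖x‖ ^ β := by
    filter_upwards [hu_lim.eventually (gt_mem_nhds hc),
      (isCompact_singleton (x := (0 : EuclideanSpace ℝ (Fin n)))).compl_mem_cocompact]
      with y hy hy0
    have hpos : 0 < ‖y‖ ^ β := Real.rpow_pos_of_pos (norm_pos_iff.mpr hy0) β
    rw [div_lt_iff₀ hpos] at hy
    linarith
  have hcont' : Continuous fun y : EuclideanSpace ℝ (Fin n) => u y - c * ‖y‖ ^ β :=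
    hcont.sub (continuous_const.mul (continuous_norm.rpow_const fun _ => Or.inr hβ.le))
  obtain ⟨z, hz⟩ := hcont'.exists_forall_ge' x hfar
  have hzpos : c * ‖z‖ ^ β < u z := by linarith [hz x]
  have hz0 : z ≠ 0 := by
    rintro rfl
    simp [hu_zero, Real.zero_rpow hβ.ne'] at hzpos
  have hznorm : 0 < ‖z‖ := norm_pos_iff.mpr hz0
  -- The power need not be `C²` at the origin, so the local form of the test is needed.
  have hle := hu.le_infLaplacian (Or.inr hz0)
    (contDiffAt_const.mul (contDiffAt_norm_rpow_of_ne_zero hz0 β)) (Eventually.of_forall hz)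
  rw [infLaplacian_const_mul_norm_rpow hz0] at hle
  refine absurd hle (not_le.mpr ?_)
  calc c ^ 3 * (β ^ 3 * (β - 1)) * ‖z‖ ^ (3 * β - 4)
      < c ^ m * ‖z‖ ^ (3 * β - 4) := by gcongr
    _ = ‖z‖ ^ α * (c * ‖z‖ ^ β) ^ m := by
        rw [hβ', Real.rpow_add hznorm, Real.mul_rpow hc.le (by positivity),
          Real.rpow_mul hznorm.le]
        ring
    -- Since `m ≥ 0`, `t ^ m` is monotone, and `u z` lies above the barrier.
    _ ≤ ‖z‖ ^ α * u z ^ m := by gcongr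

/-- For `m < 3` a small multiple of `c ^ 3` is dominated by `c ^ m` as `c → 0⁺`. -/
theorem eventually_pow_three_mul_lt_rpow {m : ℝ} (hm : m < 3) (K : ℝ) :
    ∀ᶠ c : ℝ in 𝓝[>] 0, c ^ 3 * K < c ^ m := by
  have hlim : Tendsto (fun c : ℝ => c ^ (3 - m) * K) (𝓝[>] 0) (𝓝 0) := by
    have h := (Real.continuousAt_rpow_const 0 (3 - m) (Or.inr (by linarith))).tendsto.mul_const K
    rw [Real.zero_rpow (by linarith), zero_mul] at h
    exact h.mono_left nhdsWithin_le_nhds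
  filter_upwards [hlim.eventually (gt_mem_nhds one_pos), self_mem_nhdsWithin] with c hc hpos
  have hpos' : 0 < c := hpos
  have hsplit : c ^ 3 = c ^ m * c ^ (3 - m) := by
    rw [← Real.rpow_add hpos', ← Real.rpow_natCast]
    congr 1
    push_cast
    ring
  rw [hsplit, mul_assoc]
  exact mul_lt_of_lt_one_right (Real.rpow_pos_of_pos hpos' m) hc

theorem theorem1p3 (n : ℕ) (hn : 2 ≤ n) (m α : ℝ) (hm₀ : 0 ≤ m) (hm₃ : m < 3)
    (hα : -(4 / 3) * m < α) (u : EuclideanSpace ℝ (Fin n) → ℝ)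
    (hu : IsEntireViscositySolution α m u) (hu_nonneg : ∀ x, 0 ≤ u x) (hu_zero : u 0 = 0)
    (hu_lim : Tendsto (fun x : EuclideanSpace ℝ (Fin n) => u x / ‖x‖ ^ ((4 + α) / (3 - m)))
      (cocompact (EuclideanSpace ℝ (Fin n))) (𝓝 0)) :
    ∀ x, u x = 0 := by
  intro x
  have h3 : 0 < 3 - m := by linarith
  set β := (4 + α) / (3 - m) with hβ_def
  -- `α > -4m/3 > -4` because `m < 3`.
  have hβ : 0 < β := div_pos (by linarith) h3
  have hβ' : 3 * β - 4 = α + β * m := by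
    rw [hβ_def]
    field_simp
    ring
  have hbound : ∀ᶠ c : ℝ in 𝓝[>] 0, u x ≤ c * ‖x‖ ^ β := by
    filter_upwards [eventually_pow_three_mul_lt_rpow hm₃ (β ^ 3 * (β - 1)), self_mem_nhdsWithin]
      with c hc hpos
    exact hu.subsolution.le_const_mul_norm_rpow hm₀ hβ hβ' hpos hc hu.continuous hu_zero hu_lim x
  have hlim : Tendsto (fun c : ℝ => c * ‖x‖ ^ β) (𝓝[>] 0) (𝓝 0) := by
    have h : Tendsto (fun c : ℝ => c * ‖x‖ ^ β) (𝓝 0) (𝓝 (0 * ‖x‖ ^ β)) :=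
      tendsto_id.mul_const _
    rw [zero_mul] at h
    exact h.mono_left nhdsWithin_le_nhds
  exact le_antisymm (ge_of_tendsto hlim hbound) (hu_nonneg x)
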